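/- Conventions. $\{0,1\}^*$ is the set of finite binary words, $|w|$ the length of $w$, $x_{1:n}$ the prefix of length $n$ of $x\in\{0,1\}^{\mathbb N}$, and $\langle v,w\rangle := 1^{|v|}0vw$. A partial function $\varphi:\{0,1\}^*\times\{0,1\}^{\mathbb N}\rightharpoonup\{0,1\}^*$ is computable if a single algorithm that may query the bits of its second argument (the oracle) computes it. A computable $U$ is universal if for every computable $\varphi$ there is $p\in\{0,1\}^*$ with $\varphi(w,x)=U(\langle p,w\rangle,x)$ for all $w,x$ (both sides being defined for the same $w,x$). Fix any universal $U$; let $K[w|x]$ be the length of a shortest $v$ with $U(v,x)=w$, and for $\beta\in(1,2)$ let $K[w|\beta]:=K[w|\mathbf y_\beta]$, where $\mathbf y_\beta$ is the greedy (lexicographically largest) binary expansion of $\beta-1$. Let $\Omega_\beta$ be the set of $x\in\{0,1\}^{\mathbb N}$ with $s:=\sum_{i\ge1}x_i\beta^{-i}\le1$. For $x\in\Omega_\beta$ let $y$ be the greedy binary expansion of $s$, let $n(\beta):=\lceil n\log_\beta 2\rceil$, and let $\underline\Delta_\beta(x)$ and $\bar\Delta_\beta(x)$ be the $\liminf$ and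 the $\limsup$, as $n\to\infty$, of $\frac1n\bigl(K[x_{1:n(\beta)}|\beta]-K[y_{1:n}|\beta]\bigr)$. Let $\mathscr C$ be the set of real algebraic integers $\beta$ whose minimal polynomial over $\mathbb Z$ has constant term of absolute value at least $2$, and for such $\beta$ let $G_\beta^+$ be the set of complex roots $z\ne\beta$ of the minimal polynomial with $|z|>1$. Theorem. (1) Let $\beta\in(1,2)$ with $\beta\in\mathscr C$. If $v,w$ are binary words of the same length $n$ and $\sum_{i=1}^n v_i\beta^{-i}=\sum_{i=1}^n w_i\beta^{-i}$, then $v=w$; in particular, for every $x\in\{0,1\}^{\mathbb N}$ and every $n$, $x_{1:n}$ is the lexicographically largest word of length $n$ having its sum. Moreover, for all $x\in\Omega_\beta$, $$0\le\underline\Delta_\beta(x)\le\bar\Delta_\beta(x)\le\sum_{z\in G_\beta^+}\log_\beta|z|.$$ (2) Let $k\ge2$ and $m\ge1$ be integers with $\beta:=k^{1/m}<2$. Then $\beta\in(1,2)$, $\beta\in\mathscr C$, and $0\le\underline\Delta_\beta(x)\le\bar\Delta_\beta(x)\le m-1$ for all $x\in\Omega_\beta$. If $X^m-k$ is irreducible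 over $\mathbb Z$, then it is the minimal polynomial of $\beta$, and $\sum_{z\in G_\beta^+}\log_\beta|z|=m-1$. -/

import Mathlib

open Filter Polynomial

noncomputable section

namespace BetaExp

/-! ### Computable functionals, universal functionals, algorithmic complexity -/

/-- Partial recursive functionals with an oracle: `F x n` is the (possibly undefined) output of one
fixed algorithm on input `n` when it may query the bits of the infinite binary sequence `x`.
The constructors are those of `Nat.Partrec` together with the oracle query, uniformly in `x`. -/
inductive OraclePartrec : ((ℕ → Bool) → ℕ →. ℕ) → Prop
  | zero : OraclePartrec fun _ _ => Part.some 0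
  | succ : OraclePartrec fun _ n => Part.some (n + 1)
  | left : OraclePartrec fun _ n => Part.some n.unpair.1
  | right : OraclePartrec fun _ n => Part.some n.unpair.2
  | oracle : OraclePartrec fun x n => Part.some (x n).toNat
  | pair {F G : (ℕ → Bool) → ℕ →. ℕ} (hF : OraclePartrec F) (hG : OraclePartrec G) :
      OraclePartrec fun x n => Nat.pair <$> F x n <*> G x n
  | comp {F G : (ℕ → Bool) → ℕ →. ℕ} (hF : OraclePartrec F) (hG : OraclePartrec G) :
      OraclePartrec fun x n => G x n >>= F x
  | prec {F G : (ℕ → Bool) → ℕ →. ℕ} (hF : OraclePartrec F) (hG : OraclePartrec G) :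
      OraclePartrec fun x p =>
        let (a, n) := Nat.unpair p
        n.rec (F x a) fun y IH => do
          let i ← IH
          G x (Nat.pair a (Nat.pair y i))
  | rfind {F : (ℕ → Bool) → ℕ →. ℕ} (hF : OraclePartrec F) :
      OraclePartrec fun x a =>
        Nat.rfind fun n => (fun m => decide (m = 0)) <$> F x (Nat.pair a n)

/-- A (partial) functional from finite binary words and infinite binary sequences to finite binary
words is computable if some oracle algorithm computes it. -/
def ComputableFunctional (φ : List Bool → (ℕ → Bool) → Part (List Bool)) : Prop :=
  OraclePartrec fun x n =>
    (Part.ofOption (Encodable.decode (α := List Bool) n)).bind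
      fun w => (φ w x).map Encodable.encode

/-- `⟨x, y⟩ = 1^{|x|} 0 x y`. -/
def pairWord (x y : List Bool) : List Bool :=
  List.replicate x.length true ++ false :: (x ++ y)

/-- `U` is a universal computable function: it is computable and every computable `φ` has a program
`p` with `φ(w, x) = U(⟨p, w⟩, x)`, both sides being defined for the same `w` and `x`. -/
def IsUniversal (U : List Bool → (ℕ → Bool) → Part (List Bool)) : Prop :=
  ComputableFunctional U ∧
    ∀ φ : List Bool → (ℕ → Bool) → Part (List Bool), ComputableFunctional φ →
      ∃ p : List Bool, ∀ (w : List Bool) (x : ℕ → Bool), φ w x = U (pairWord p w) x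

/-- `K_U[w | x]`: the length of a shortest `v` with `U(v, x) = w`. -/
def complexity (U : List Bool → (ℕ → Bool) → Part (List Bool)) (w : List Bool)
    (x : ℕ → Bool) : ℕ :=
  sInf {l : ℕ | ∃ v : List Bool, v.length = l ∧ w ∈ U v x}

/-! ### Expansions.  The sequence `x : ℕ → Bool` stands for `x 0, x 1, …`, so that `x i` is the
digit of weight `β ^ (-(i + 1))`. -/

/-- The prefix of length `n`. -/
def pre (x : ℕ → Bool) (n : ℕ) : List Bool := List.ofFn fun i : Fin n => x i

/-- `∑ i, x_i β^{-i}` for an infinite sequence. -/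
def value (β : ℝ) (x : ℕ → Bool) : ℝ := ∑' i : ℕ, ((x i).toNat : ℝ) * β⁻¹ ^ (i + 1)

/-- `∑ i, x_i β^{-i}` for a finite word. -/
def wordValue (β : ℝ) (w : List Bool) : ℝ :=
  ∑ i : Fin w.length, ((w.get i).toNat : ℝ) * β⁻¹ ^ ((i : ℕ) + 1)

/-- Words of the same length and the same value. -/
def BetaEquiv (β : ℝ) (v w : List Bool) : Prop :=
  v.length = w.length ∧ wordValue β v = wordValue β w

/-- The sequences that are `β`-expansions of a number in `[0, 1]`. -/
def Omega (β : ℝ) : Set (ℕ → Bool) := {x | value β x ≤ 1}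

/-- The remainders of the greedy algorithm in base `2`. -/
def greedyRem (s : ℝ) : ℕ → ℝ
  | 0 => s
  | n + 1 => 2 * greedyRem s n - (if 1 / 2 ≤ greedyRem s n then 1 else 0)

/-- The greedy binary expansion of `s ∈ [0, 1]`. -/
def greedyBinary (s : ℝ) (n : ℕ) : Bool := decide (1 / 2 ≤ greedyRem s n)

lemma greedyRem_mem {s : ℝ} (h0 : 0 ≤ s) (h1 : s ≤ 1) (n : ℕ) :
    0 ≤ greedyRem s n ∧ greedyRem s n ≤ 1 := by
  induction n with
  | zero => exact ⟨h0, h1⟩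
  | succ n ih =>
    rw [greedyRem]
    split_ifs with h
    · constructor <;> linarith [ih.2]
    · constructor <;> linarith [ih.1]

lemma sum_add_greedyRem (s : ℝ) (n : ℕ) :
    (∑ i ∈ Finset.range n, ((greedyBinary s i).toNat : ℝ) * (2 : ℝ)⁻¹ ^ (i + 1))
      + (2 : ℝ)⁻¹ ^ n * greedyRem s n = s := by
  induction n with
  | zero => simp [greedyRem]
  | succ n ih =>
    rw [Finset.sum_range_succ, greedyRem]
    conv_rhs => rw [← ih]
    by_cases h : 1 / 2 ≤ greedyRem s n
    · simp only [greedyBinary, h, if_true, decide_true, Bool.toNat_true]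
      push_cast
      ring
    · simp only [greedyBinary, h, if_false, decide_false, Bool.toNat_false]
      push_cast
      ring

/-- `greedyBinary s` is a binary expansion of `s`, and it is lexicographically larger than every
other binary expansion of `s`. -/
theorem greedyBinary_spec {s : ℝ} (h0 : 0 ≤ s) (h1 : s ≤ 1) :
    HasSum (fun i : ℕ => ((greedyBinary s i).toNat : ℝ) * (2 : ℝ)⁻¹ ^ (i + 1)) s ∧
    ∀ z : ℕ → Bool, HasSum (fun i : ℕ => ((z i).toNat : ℝ) * (2 : ℝ)⁻¹ ^ (i + 1)) s →
      z ≠ greedyBinary s →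
      ∃ j, (∀ i < j, z i = greedyBinary s i) ∧ z j = false ∧ greedyBinary s j = true := by
  constructor
  · rw [hasSum_iff_tendsto_nat_of_nonneg (fun i => by positivity)]
    have hz : Tendsto (fun n : ℕ => (2 : ℝ)⁻¹ ^ n * greedyRem s n) atTop (nhds 0) := by
      refine squeeze_zero (fun n => mul_nonneg (by positivity) (greedyRem_mem h0 h1 n).1)
        (fun n => mul_le_of_le_one_right (by positivity) (greedyRem_mem h0 h1 n).2)
        (tendsto_pow_atTop_nhds_zero_of_lt_one (by norm_num) (by norm_num))
    have h2 := (tendsto_const_nhds (x := s)).sub hz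
    rw [sub_zero] at h2
    refine h2.congr fun n => ?_
    linarith [sum_add_greedyRem s n]
  · intro z hz hne
    have hex : ∃ j, z j ≠ greedyBinary s j := Function.ne_iff.1 hne
    classical
    have hj := Nat.find_spec hex
    have hlt : ∀ i < Nat.find hex, z i = greedyBinary s i := fun i hi =>
      not_not.1 (Nat.find_min hex hi)
    generalize Nat.find hex = j at hj hlt
    refine ⟨j, hlt, ?_⟩
    cases hy : greedyBinary s j with
    | true => rw [hy] at hj; simpa using hj
    | false =>
      exfalso
      rw [hy] at hj
      have hzj : z j = true := by simpa using hj
      have hr : greedyRem s j < 1 / 2 := by simpa [greedyBinary] using hy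
      have hle := sum_le_hasSum (Finset.range (j + 1)) (fun i _ => by positivity) hz
      rw [Finset.sum_range_succ, hzj,
        Finset.sum_congr rfl (fun i hi => by rw [hlt i (Finset.mem_range.1 hi)])] at hle
      have hs := sum_add_greedyRem s j
      have hp : (0 : ℝ) < (2 : ℝ)⁻¹ ^ j := by positivity
      rw [pow_succ] at hle
      simp only [Bool.toNat_true, Nat.cast_one, one_mul] at hle
      nlinarith

/-! ### Complexity relative to `β` and relative compressibility -/

/-- `K_U[w | β]`: complexity relative to the greedy binary expansion of `β - 1`. -/
def complexityRel (U : List Bool → (ℕ → Bool) → Part (List Bool)) (w : List Bool) (β : ℝ) : ℕ :=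
  complexity U w (greedyBinary (β - 1))

/-- `n(β) = ⌈n log_β 2⌉`. -/
def scaledLength (β : ℝ) (n : ℕ) : ℕ := ⌈(n : ℝ) * Real.logb β 2⌉₊

/-- `(K[x_{1:n(β)} | β] - K[y_{1:n} | β]) / n`, with `y` the greedy binary expansion of the number
of which `x` is a `β`-expansion. -/
def complexityGap (U : List Bool → (ℕ → Bool) → Part (List Bool)) (β : ℝ) (x : ℕ → Bool)
    (n : ℕ) : ℝ :=
  ((complexityRel U (pre x (scaledLength β n)) β : ℝ)
    - (complexityRel U (pre (greedyBinary (value β x)) n) β : ℝ)) / n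

def lowerDelta (U : List Bool → (ℕ → Bool) → Part (List Bool)) (β : ℝ) (x : ℕ → Bool) : EReal :=
  liminf (fun n : ℕ => ((complexityGap U β x n : ℝ) : EReal)) atTop

def upperDelta (U : List Bool → (ℕ → Bool) → Part (List Bool)) (β : ℝ) (x : ℕ → Bool) : EReal :=
  limsup (fun n : ℕ => ((complexityGap U β x n : ℝ) : EReal)) atTop

/-! ### The algebraic data -/

/-- Algebraic integers whose minimal polynomial has constant term of absolute value at least `2`. -/
def ClassC (β : ℝ) : Prop := IsIntegral ℤ β ∧ 2 ≤ |(minpoly ℤ β).coeff 0|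

/-- The complex roots, other than `β`, of the minimal polynomial of the algebraic integer `β`. -/
def galoisConjugates (β : ℝ) : Finset ℂ := ((minpoly ℤ β).aroots ℂ).toFinset.erase (β : ℂ)

/-- The conjugates outside the closed unit disk. -/
def outerConjugates (β : ℝ) : Finset ℂ := {z ∈ galoisConjugates β | 1 < ‖z‖}

/-- `∑ log_β |z|` over the conjugates `z` outside the closed unit disk. -/
def conjugateBound (β : ℝ) : ℝ := ∑ z ∈ outerConjugates β, Real.logb β ‖z‖

end BetaExp

end

noncomputable section

namespace BetaExp

/-! ### Oracle computability on encoded types -/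

/-! Write N = n(β). The prefixes `x_{1:N}` and `y_{1:n}` have values, in bases β and 2, that differ
by O(2^{-n}), because β^{-N} ≤ 2^{-n}. A prefix of the oracle of length O(n) suffices to test this
closeness (`closeTest`). So either prefix can be described by the other, O(log n) bits of length
data, and an index into the list of words passing the test (`exists_complexity_le_add_clog`). The
complexity gap is thus controlled by the logarithms of two list lengths.

Binary words of length n are 2^{-n}-separated, so O(1) of them are candidates; this gives the lower
bound 0. For β in the class, the difference of two β-words of length N is β^{-N} q(β), with q an
integer polynomial with coefficients in {-1, 0, 1}. If q(β) ≠ 0, the product of q over all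
conjugates is a nonzero integer (`one_le_norm_prod_aeval`). The other d factors are at most N
max(1,|z|)^N, so the separation is at least (β^N N^d P^N)^{-1}, where P is `outerProd β`. Since β^N
≤ β 2^n, there are O(N^d P^N) candidates. As N/n → log_β 2, the logarithm divided by n tends to
log_β P.

Injectivity comes from the constant term: the minimal polynomial divides q, whose constant
coefficient has absolute value at most 1, so the last digits agree and can be stripped. For β =
k^{1/m} all conjugates have modulus β, which gives both membership in the class and the bound. -/

/-- Computability with an oracle for partial functions between `Primcodable` types. -/
def OracleComputable {α σ : Type*} [Primcodable α] [Primcodable σ]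
    (f : (ℕ → Bool) → α →. σ) : Prop :=
  OraclePartrec fun x n =>
    Part.bind (Part.ofOption (Encodable.decode (α := α) n)) fun a => (f x a).map Encodable.encode

theorem OraclePartrec.of_partrec {f : ℕ →. ℕ} (hf : Nat.Partrec f) :
    OraclePartrec fun _ => f := by
  induction hf with
  | zero => exact .zero
  | succ => exact .succ
  | left => exact .left
  | right => exact .right
  | pair _ _ hf hg => exact .pair hf hg
  | comp _ _ hf hg => exact .comp hf hg
  | prec _ _ hf hg => exact .prec hf hg
  | rfind _ hf => exact .rfind hf

section

variable {α β σ : Type*} [Primcodable α] [Primcodable β] [Primcodable σ]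

theorem OracleComputable.of_partrec {f : α →. σ} (hf : Partrec f) :
    OracleComputable fun _ => f :=
  OraclePartrec.of_partrec hf

theorem OracleComputable.of_computable {f : α → σ} (hf : Computable f) :
    OracleComputable fun _ a => Part.some (f a) :=
  OracleComputable.of_partrec hf

theorem OracleComputable.comp {g : (ℕ → Bool) → β →. σ} {f : (ℕ → Bool) → α →. β}
    (hg : OracleComputable g) (hf : OracleComputable f) :
    OracleComputable fun x a => (f x a).bind (g x) := by
  refine (congrArg OraclePartrec (funext fun x => funext fun n => ?_)).mp
    (OraclePartrec.comp hg hf)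
  simp only [← Part.bind_some_eq_map, Part.bind_eq_bind, Part.bind_assoc, Part.bind_some,
    Encodable.encodek, Part.ofOption]
  exact congrArg _ (funext fun a => (Part.bind_assoc _ _ _).symm)

/-- Carrying the input along lets a later stage depend on it as well as on earlier outputs. -/
theorem OracleComputable.prodMk_bind {f : (ℕ → Bool) → α →. β}
    (hf : OracleComputable f) :
    OracleComputable fun x a => (f x a).map fun b => (a, b) := by
  have hid : OracleComputable fun _ (a : α) => Part.some a :=
    .of_computable Computable.id
  refine (congrArg OraclePartrec (funext fun x => funext fun n => ?_)).mp
    (OraclePartrec.pair hid hf)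
  cases Encodable.decode (α := α) n <;>
    simp [Seq.seq, Part.map_map, Part.map_some, Function.comp_def]

theorem OracleComputable.bind {f : (ℕ → Bool) → α →. β} {g : (ℕ → Bool) → α × β →. σ}
    (hf : OracleComputable f) (hg : OracleComputable g) :
    OracleComputable fun x a => (f x a).bind fun b => g x (a, b) := by
  refine (congrArg OracleComputable (funext fun x => funext fun a => ?_)).mp
    (hg.comp hf.prodMk_bind)
  exact Part.bind_map _ _ _

end

theorem pre_succ (x : ℕ → Bool) (n : ℕ) : pre x (n + 1) = pre x n ++ [x n] := by
  rw [pre, List.ofFn_succ_last]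
  simp [pre]

@[simp] theorem length_pre (x : ℕ → Bool) (n : ℕ) : (pre x n).length = n := by simp [pre]

theorem OracleComputable.pre : OracleComputable fun x (n : ℕ) => Part.some (pre x n) := by
  have hstep : Computable₂ fun (i b : ℕ) =>
      Encodable.encode (((Encodable.decode (α := List Bool) i).getD []) ++ [decide (b = 1)]) := by
    refine Computable.encode.comp (Primrec.to_comp ?_)
    refine Primrec.list_append.comp ?_ ?_
    · exact Primrec.option_getD.comp (Primrec.decode.comp Primrec.fst) (Primrec.const [])
    · refine Primrec.list_cons.comp ?_ (Primrec.const [])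
      exact (Primrec.eq.comp Primrec.snd (Primrec.const 1)).decide
  have hstep' : OraclePartrec fun _ n =>
      Part.some (Encodable.encode (((Encodable.decode (α := List Bool) n.unpair.1).getD [])
        ++ [decide (n.unpair.2 = 1)])) := by
    have := hstep.comp (Computable.fst.comp Computable.unpair)
      (Computable.snd.comp Computable.unpair)
    have h2 := OracleComputable.of_computable this
    simpa [OracleComputable, Part.bind_some] using h2
  -- The recursion step receives ⟨a, ⟨y, i⟩⟩: i codes the word built so far and y is the index of
  -- the bit to query.
  have hG := OraclePartrec.comp hstep'
    (.pair (.comp .right .right) (.comp .oracle (.comp .left .right)))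
  have hF := OraclePartrec.of_partrec (f := fun _ => Part.some (Encodable.encode ([] : List Bool)))
    (Nat.Partrec.of_primrec (Nat.Primrec.const _))
  refine (congrArg OraclePartrec (funext fun x => funext fun n => ?_)).mp
    -- The recursion takes a parameter, here the dummy value 0.
    (OraclePartrec.comp (OraclePartrec.prec hF hG)
    (.pair (.of_partrec (Nat.Partrec.of_primrec (Nat.Primrec.const 0)))
      (OracleComputable.of_computable (α := ℕ) Computable.id)))
  simp [Seq.seq]
  induction n with
  | zero => rfl
  | succ n ih =>
    cases hx : x n <;> simp [pre_succ, hx] <;> rw [ih] <;> simp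

/-! ### Describing a word by its position in a computable list of candidates -/

/-- All binary words of length `n`. -/
def allWords : ℕ → List (List Bool)
  | 0 => [[]]
  | n + 1 => (allWords n).flatMap fun w => [false :: w, true :: w]

theorem mem_allWords {n : ℕ} {w : List Bool} : w ∈ allWords n ↔ w.length = n := by
  induction n generalizing w with
  | zero => simp [allWords]
  | succ n ih =>
    cases w with
    | nil => simp [allWords]
    | cons b w => cases b <;> simp [allWords, ih]

theorem nodup_allWords (n : ℕ) : (allWords n).Nodup := by
  induction n with
  | zero => simp [allWords]
  | succ n ih =>
    refine List.nodup_flatMap.2 ⟨fun w _ => by simp, ih.imp fun {v w} h => ?_⟩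
    simp [Function.onFun, Ne.symm h]

theorem length_allWords (n : ℕ) : (allWords n).length = 2 ^ n := by
  induction n with
  | zero => simp [allWords]
  | succ n ih => simp [allWords, List.length_flatMap, ih, pow_succ]

theorem primrec_allWords : Primrec allWords := by
  refine (Primrec.nat_rec₁ (f := fun _ l => l.flatMap fun w => [false :: w, true :: w])
    [([] : List Bool)] ?_).of_eq fun n => ?_
  · refine Primrec.list_flatMap Primrec.snd ?_
    have h (b : Bool) : Primrec fun q : (ℕ × List (List Bool)) × List Bool => b :: q.2 :=
      Primrec.list_cons.comp (Primrec.const b) Primrec.snd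
    exact Primrec.list_cons.comp (h false) (Primrec.list_cons.comp (h true) (Primrec.const []))
  · induction n with
    | zero => rfl
    | succ n ih => simp only [allWords, ← ih]

/-- The number with the given binary digits, least significant digit first. -/
def bitsToNat (w : List Bool) : ℕ := w.foldr (fun b n => 2 * n + b.toNat) 0

theorem primrec_boolToNat : Primrec Bool.toNat :=
  Primrec.dom_finite _

theorem primrec_bitsToNat : Primrec bitsToNat := by
  refine Primrec.list_foldr (f := fun w : List Bool => w) (g := fun _ => 0)
    (h := fun _ q => 2 * q.2 + q.1.toNat) Primrec.id (Primrec.const 0) ?_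
  exact Primrec.nat_add.comp
    (Primrec.nat_mul.comp (Primrec.const 2) (Primrec.snd.comp Primrec.snd))
    (primrec_boolToNat.comp (Primrec.fst.comp Primrec.snd))

/-- Numerals are padded to an exact width, so knowing the width is enough to cut one off the front
of a program. -/
theorem exists_bitsToNat_eq {k t : ℕ} (h : t < 2 ^ k) :
    ∃ w : List Bool, w.length = k ∧ bitsToNat w = t := by
  induction k generalizing t with
  | zero => exact ⟨[], rfl, by simp at h; simp [bitsToNat, h]⟩
  | succ k ih =>
    obtain ⟨w, hw, ht⟩ := ih (t := t / 2) (by omega)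
    refine ⟨decide (t % 2 = 1) :: w, by simp [hw], ?_⟩
    change 2 * bitsToNat w + _ = t
    rw [ht]
    rcases Nat.mod_two_eq_zero_or_one t with h0 | h0 <;> simp [h0] <;> omega

/-! ### Self-delimiting pairs and candidate lists -/

/-- The first and the second component of a pair of words, decoded from `pairWord`. -/
def unpairWord (w : List Bool) : List Bool × List Bool :=
  let k := w.findIdx fun b => !b
  ((w.drop (k + 1)).take k, (w.drop (k + 1)).drop k)

theorem unpairWord_pairWord (v w : List Bool) : unpairWord (pairWord v w) = (v, w) := by
  have h : (pairWord v w).findIdx (fun b => !b) = v.length := by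
    rw [pairWord, List.findIdx_append]
    have : (List.replicate v.length true).findIdx (fun b => !b) = v.length := by
      conv_rhs => rw [← List.length_replicate (n := v.length) (a := true)]
      rw [List.findIdx_eq_length]
      simp
    simp [this, List.findIdx_cons]
  have hd : (pairWord v w).drop (v.length + 1) = v ++ w := by
    rw [pairWord, List.drop_append]
    simp
  simp only [unpairWord, h, hd]
  simp

/-- The first component costs two bits per digit, so it is reserved for data of logarithmic or
constant size. -/
theorem length_pairWord (v w : List Bool) :
    (pairWord v w).length = 2 * v.length + 1 + w.length := by
  simp [pairWord]; ring

theorem primrec_unpairWord : Primrec unpairWord := by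
  have hk : Primrec fun w : List Bool => w.findIdx fun b => !b :=
    Primrec.list_findIdx Primrec.id (Primrec.not.comp Primrec.snd)
  have hd : Primrec fun w : List Bool => w.drop (w.findIdx (fun b => !b) + 1) :=
    Primrec.list_drop.comp (Primrec.succ.comp hk) Primrec.id
  exact Primrec.pair (Primrec.list_take.comp hk hd) (Primrec.list_drop.comp hk hd)

/-- The words `b` of length `L` with `R a b z`. -/
def candidates (R : List Bool → List Bool → List Bool → Bool) (a : List Bool) (L : ℕ)
    (z : List Bool) : List (List Bool) :=
  (allWords L).filter fun b => R a b z

theorem mem_candidates {R : List Bool → List Bool → List Bool → Bool} {a b z : List Bool}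
    {L : ℕ} : b ∈ candidates R a L z ↔ b.length = L ∧ R a b z = true := by
  simp [candidates, mem_allWords]

theorem length_candidates_le (R : List Bool → List Bool → List Bool → Bool) (a : List Bool)
    (L : ℕ) (z : List Bool) : (candidates R a L z).length ≤ 2 ^ L :=
  (List.length_filter_le _ _).trans (length_allWords L).le

theorem primrec_candidates {R : List Bool → List Bool → List Bool → Bool}
    (hR : Primrec fun q : (List Bool × List Bool) × List Bool => R q.1.1 q.1.2 q.2) :
    Primrec fun q : (List Bool × ℕ) × List Bool => candidates R q.1.1 q.1.2 q.2 := by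
  have h : Primrec fun q : (List Bool × ℕ) × List Bool =>
      (allWords q.1.2).flatMap fun b => bif R q.1.1 b q.2 then [b] else [] := by
    refine Primrec.list_flatMap
      (primrec_allWords.comp (Primrec.snd.comp Primrec.fst)) ?_
    refine Primrec.cond ?_ (Primrec.list_cons.comp Primrec.snd (Primrec.const []))
      (Primrec.const [])
    exact hR.comp (Primrec.pair (Primrec.pair
      (Primrec.fst.comp (Primrec.fst.comp Primrec.fst)) Primrec.snd)
      (Primrec.snd.comp Primrec.fst))
  refine h.of_eq fun q => ?_
  rw [candidates]
  induction allWords q.1.2 with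
  | nil => rfl
  | cons b l ih =>
    rw [List.flatMap_cons, ih, List.filter_cons]
    cases R q.1.1 b q.2 <;> simp

/-- Every word has a program. -/
theorem exists_program {U : List Bool → (ℕ → Bool) → Part (List Bool)} (hU : IsUniversal U)
    (w : List Bool) (x : ℕ → Bool) :
    ∃ v : List Bool, v.length = complexity U w x ∧ w ∈ U v x := by
  -- A program for the identity makes the set of lengths nonempty, so its infimum is attained.
  obtain ⟨p, hp⟩ := hU.2 (fun w _ => Part.some w)
    (OracleComputable.of_computable (α := List Bool) Computable.id)
  refine Nat.sInf_mem (s := {l : ℕ | ∃ v : List Bool, v.length = l ∧ w ∈ U v x})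
    ⟨_, pairWord p w, rfl, ?_⟩
  rw [← hp w x]
  exact Part.mem_some w

theorem complexity_le {U : List Bool → (ℕ → Bool) → Part (List Bool)} {v w : List Bool}
    {x : ℕ → Bool} (h : w ∈ U v x) : complexity U w x ≤ v.length :=
  Nat.sInf_le ⟨v, rfl, h⟩

/-- A word is described by a related word, its own length, and its position in the list of all
words of that length which satisfy the relation. -/
theorem exists_complexity_le_add_clog {U : List Bool → (ℕ → Bool) → Part (List Bool)}
    (hU : IsUniversal U) {R : List Bool → List Bool → List Bool → Bool}
    (hR : Primrec fun q : (List Bool × List Bool) × List Bool => R q.1.1 q.1.2 q.2) :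
    ∃ c : ℕ, ∀ (x : ℕ → Bool) (a b : List Bool),
      R a b (pre x (2 * (a.length + b.length))) = true →
      complexity U b x ≤ complexity U a x
        + Nat.clog 2 (candidates R a b.length (pre x (2 * (a.length + b.length)))).length
        + 4 * Nat.clog 2 (b.length + 1) + c := by
  -- Programs have the form ⟨t, s r⟩: t codes the pair (|b|, |s|), s is the index of b in the
  -- candidate list, and r is a shortest program for a. `T`, `j` and `p` read off the pair, the
  -- index and r.
  let T : List Bool → ℕ × ℕ := fun w => (bitsToNat (unpairWord w).1).unpair
  let p : List Bool → List Bool := fun w => (unpairWord w).2.drop (T w).2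
  let j : List Bool → ℕ := fun w => bitsToNat ((unpairWord w).2.take (T w).2)
  have hT : Primrec T :=
    Primrec.unpair.comp (primrec_bitsToNat.comp (Primrec.fst.comp primrec_unpairWord))
  have hp : Primrec p := Primrec.list_drop.comp (Primrec.snd.comp hT)
    (Primrec.snd.comp primrec_unpairWord)
  have hj : Primrec j := primrec_bitsToNat.comp (Primrec.list_take.comp (Primrec.snd.comp hT)
    (Primrec.snd.comp primrec_unpairWord))
  let m : List Bool × List Bool → ℕ := fun q => 2 * (q.2.length + (T q.1).1)
  have hm : Primrec m := Primrec.nat_mul.comp (Primrec.const 2)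
    (Primrec.nat_add.comp (Primrec.list_length.comp Primrec.snd)
      (Primrec.fst.comp (hT.comp Primrec.fst)))
  let g : (List Bool × List Bool) × List Bool → List Bool := fun q =>
    ((candidates R q.1.2 (T q.1.1).1 q.2)[j q.1.1]?).getD []
  have hg : Primrec g := by
    refine Primrec.option_getD.comp (Primrec.list_getElem?.comp ?_ ?_) (Primrec.const [])
    · exact (primrec_candidates hR).comp (Primrec.pair (Primrec.pair
        (Primrec.snd.comp Primrec.fst)
        (Primrec.fst.comp (hT.comp (Primrec.fst.comp Primrec.fst)))) Primrec.snd)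
    · exact hj.comp (Primrec.fst.comp Primrec.fst)
  have hφ : OracleComputable fun x w => (U (p w) x).bind fun u =>
      (Part.some (pre x (m (w, u)))).bind fun z => Part.some (g ((w, u), z)) := by
    have h1 : OracleComputable fun x w => (Part.some (p w)).bind fun v => U v x :=
      OracleComputable.comp (g := fun x v => U v x) hU.1 (.of_computable hp.to_comp)
    have h2 : OracleComputable fun x q => (Part.some (m q)).bind fun n => Part.some (pre x n) :=
      OracleComputable.comp .pre (.of_computable hm.to_comp)
    have h3 := h2.bind (.of_computable hg.to_comp)
    have h4 := h1.bind h3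
    simpa only [Part.bind_some] using h4
  obtain ⟨e, he⟩ := hU.2 (fun w x => (U (p w) x).bind fun u =>
      (Part.some (pre x (m (w, u)))).bind fun z => Part.some (g ((w, u), z))) hφ
  -- The two nested pairs cost (2|e| + 1) + (2|t| + 1), and |t| = 2 clog(|b| + 1) accounts for the
  -- factor 4.
  refine ⟨2 * e.length + 2, fun x a b hab => ?_⟩
  set z := pre x (2 * (a.length + b.length)) with hz
  set l := candidates R a b.length z with hl
  obtain ⟨i, hi, hib⟩ := List.getElem_of_mem (mem_candidates.2 ⟨rfl, hab⟩ : b ∈ l)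
  obtain ⟨s, hs, hsi⟩ := exists_bitsToNat_eq (hi.trans_le (Nat.le_pow_clog one_lt_two l.length))
  -- The index needs at most |b| bits, so the pair coded by t is below (|b| + 1)².
  have hlen : Nat.clog 2 l.length ≤ b.length :=
    Nat.clog_le_of_le_pow (length_candidates_le R a _ z)
  have hpair : Nat.pair b.length (Nat.clog 2 l.length)
      < 2 ^ (2 * Nat.clog 2 (b.length + 1)) := by
    refine (Nat.pair_lt_max_add_one_sq _ _).trans_le ?_
    rw [max_eq_left hlen, mul_comm, pow_mul]
    exact Nat.pow_le_pow_left (Nat.le_pow_clog one_lt_two _) 2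
  obtain ⟨t, ht, htp⟩ := exists_bitsToNat_eq hpair
  obtain ⟨r, hr, hra⟩ := exists_program hU a x
  have hTw : T (pairWord t (s ++ r)) = (b.length, Nat.clog 2 l.length) := by
    simp [T, unpairWord_pairWord, htp]
  have hpw : p (pairWord t (s ++ r)) = r := by
    simp [p, hTw, unpairWord_pairWord, ← hs]
  have hjw : j (pairWord t (s ++ r)) = i := by
    simp [j, hTw, unpairWord_pairWord, ← hs, hsi]
  have hmem : b ∈ U (pairWord e (pairWord t (s ++ r))) x := by
    rw [← he, hpw]
    refine Part.mem_bind hra ?_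
    simp only [Part.bind_some, m, hTw, ← hz, g, hjw, ← hl]
    rw [hl, List.getElem?_eq_getElem hi, hib]
    simp
  refine (complexity_le hmem).trans ?_
  rw [length_pairWord, length_pairWord, List.length_append, hs, ht, hr]
  omega

/-! ### Values of words, and a computable test for nearly equal values -/

@[simp] theorem wordValue_nil (β : ℝ) : wordValue β [] = 0 := by simp [wordValue]

theorem wordValue_cons (β : ℝ) (b : Bool) (w : List Bool) :
    wordValue β (b :: w) = β⁻¹ * (b.toNat + wordValue β w) := by
  simp only [wordValue]
  refine (Fin.sum_univ_succ (n := w.length) _).trans ?_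
  rw [mul_add, Finset.mul_sum]
  congr 1
  · simp [mul_comm]
  · exact Finset.sum_congr rfl fun i _ => by simp; ring

theorem wordValue_pre (β : ℝ) (x : ℕ → Bool) (n : ℕ) :
    wordValue β (pre x n) = ∑ i ∈ Finset.range n, ((x i).toNat : ℝ) * β⁻¹ ^ (i + 1) := by
  induction n generalizing x with
  | zero => simp [pre]
  | succ n ih =>
    have h : pre x (n + 1) = x 0 :: pre (fun i => x (i + 1)) n := by
      simp [pre, List.ofFn_succ]
    rw [h, wordValue_cons, ih, Finset.sum_range_succ', mul_add, Finset.mul_sum, add_comm]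
    congr 1
    · exact Finset.sum_congr rfl fun i _ => by ring
    · ring

theorem boolToNat_le_one (b : Bool) : (b.toNat : ℝ) ≤ 1 := by cases b <;> simp

theorem wordValue_nonneg {β : ℝ} (hβ : 0 ≤ β) (w : List Bool) : 0 ≤ wordValue β w :=
  Finset.sum_nonneg fun i _ => by positivity

theorem wordValue_le_length {β : ℝ} (hβ : 1 ≤ β) (w : List Bool) :
    wordValue β w ≤ w.length := by
  induction w with
  | nil => simp
  | cons b w ih =>
    rw [wordValue_cons]
    have h1 : β⁻¹ ≤ 1 := inv_le_one_of_one_le₀ hβ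
    have h2 := wordValue_nonneg (zero_le_one.trans hβ) w
    have h3 := boolToNat_le_one b
    calc β⁻¹ * (b.toNat + wordValue β w) ≤ 1 * (b.toNat + wordValue β w) := by gcongr
      _ ≤ _ := by push_cast [List.length_cons]; linarith

/-- Splitting off the first digit changes the value by |β⁻¹ - γ⁻¹| times a quantity at most |w| + 1,
plus the inductive error scaled by γ⁻¹ ≤ 1; then |w|² + |w| + 1 ≤ (|w| + 1)². This bounds the error
of using a truncated base. -/
theorem abs_wordValue_sub_le {β γ : ℝ} (hβ : 1 ≤ β) (hγ : 1 ≤ γ) (w : List Bool) :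
    |wordValue β w - wordValue γ w| ≤ (w.length : ℝ) ^ 2 * |β - γ| := by
  have hβ0 : 0 < β := by linarith
  have hγ0 : 0 < γ := by linarith
  have hinv : |β⁻¹ - γ⁻¹| ≤ |β - γ| := by
    rw [inv_sub_inv hβ0.ne' hγ0.ne', abs_div, abs_sub_comm γ β, abs_of_pos (mul_pos hβ0 hγ0)]
    exact div_le_self (abs_nonneg _) (one_le_mul_of_one_le_of_one_le hβ hγ)
  induction w with
  | nil => simp
  | cons b w ih =>
    have h2 := wordValue_nonneg hβ0.le w
    have h3 := boolToNat_le_one b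
    have h4 := wordValue_le_length hβ w
    have h5 : γ⁻¹ ≤ 1 := inv_le_one_of_one_le₀ hγ
    have h6 : |(b.toNat : ℝ) + wordValue β w| ≤ w.length + 1 := by
      rw [abs_of_nonneg (by positivity)]; linarith
    rw [wordValue_cons, wordValue_cons]
    calc |β⁻¹ * (b.toNat + wordValue β w) - γ⁻¹ * (b.toNat + wordValue γ w)|
        = |(β⁻¹ - γ⁻¹) * (b.toNat + wordValue β w)
            + γ⁻¹ * (wordValue β w - wordValue γ w)| := by ring_nf
      _ ≤ |β⁻¹ - γ⁻¹| * |b.toNat + wordValue β w|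
            + |γ⁻¹| * |wordValue β w - wordValue γ w| := by
          rw [← abs_mul, ← abs_mul]; exact abs_add_le _ _
      _ ≤ |β - γ| * (w.length + 1) + 1 * ((w.length : ℝ) ^ 2 * |β - γ|) := by
          rw [abs_of_pos (inv_pos.2 hγ0)]
          gcongr
      _ ≤ _ := by
          push_cast [List.length_cons]
          nlinarith [mul_nonneg (Nat.cast_nonneg (α := ℝ) w.length) (abs_nonneg (β - γ))]

/-- The value of a word in the rational base `Q / P`, as a numerator and a denominator. -/
def fracValue (P Q : ℕ) (w : List Bool) : ℕ × ℕ :=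
  w.foldr (fun b s => (P * (b.toNat * s.2 + s.1), Q * s.2)) (0, 1)

theorem fracValue_snd (P Q : ℕ) (w : List Bool) : (fracValue P Q w).2 = Q ^ w.length := by
  induction w with
  | nil => rfl
  | cons b w ih =>
    change Q * (fracValue P Q w).2 = _
    rw [ih, List.length_cons, pow_succ, mul_comm]

theorem fracValue_div {P Q : ℕ} (hQ : 0 < Q) (w : List Bool) :
    ((fracValue P Q w).1 : ℝ) / (fracValue P Q w).2 = wordValue ((Q : ℝ) / P) w := by
  induction w with
  | nil => simp [fracValue]
  | cons b w ih =>
    rw [wordValue_cons, ← ih]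
    change ((P * (b.toNat * (fracValue P Q w).2 + (fracValue P Q w).1) : ℕ) : ℝ)
      / ((Q * (fracValue P Q w).2 : ℕ) : ℝ) = _
    have h : ((fracValue P Q w).2 : ℝ) ≠ 0 := by rw [fracValue_snd]; positivity
    have hQ' : (Q : ℝ) ≠ 0 := by positivity
    push_cast
    field_simp

theorem primrec_fracValue :
    Primrec fun q : (ℕ × ℕ) × List Bool => fracValue q.1.1 q.1.2 q.2 := by
  refine Primrec.list_foldr (f := fun q : (ℕ × ℕ) × List Bool => q.2)
    (g := fun _ => ((0, 1) : ℕ × ℕ))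
    (h := fun q r => (q.1.1 * (r.1.toNat * r.2.2 + r.2.1), q.1.2 * r.2.2))
    Primrec.snd (Primrec.const _) ?_
  have hs : Primrec fun r : ((ℕ × ℕ) × List Bool) × (Bool × (ℕ × ℕ)) => r.2.2.2 :=
    Primrec.snd.comp (Primrec.snd.comp Primrec.snd)
  refine Primrec.pair (Primrec.nat_mul.comp (Primrec.fst.comp (Primrec.fst.comp Primrec.fst))
    (Primrec.nat_add.comp (Primrec.nat_mul.comp ?_ hs)
      (Primrec.fst.comp (Primrec.snd.comp Primrec.snd))))
    (Primrec.nat_mul.comp (Primrec.snd.comp (Primrec.fst.comp Primrec.fst)) hs)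
  exact primrec_boolToNat.comp (Primrec.fst.comp Primrec.snd)

/-- Whether the values of `u` in base `1 + ∑ i, z_i 2^{-i}` and of `v` in base `2` differ by at
most `C * 2 ^ (-|v|)`. -/
def closeTest (C : ℕ) (u v z : List Bool) : Bool :=
  let B := fracValue 1 2 z
  let X := fracValue B.2 (B.2 + B.1) u
  let Y := fracValue 1 2 v
  decide (X.1 * Y.2 ≤ (Y.1 + C) * X.2) && decide (Y.1 * X.2 ≤ X.1 * Y.2 + C * X.2)

theorem primrec_closeTest (C : ℕ) :
    Primrec fun q : (List Bool × List Bool) × List Bool => closeTest C q.1.1 q.1.2 q.2 := by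
  have h2 {f : (List Bool × List Bool) × List Bool → List Bool} (hf : Primrec f) :
      Primrec fun q => fracValue 1 2 (f q) :=
    primrec_fracValue.comp (Primrec.pair (Primrec.const (1, 2)) hf)
  have hB := h2 Primrec.snd
  have hY := h2 (Primrec.snd.comp Primrec.fst)
  have hX : Primrec fun q : (List Bool × List Bool) × List Bool =>
      fracValue (fracValue 1 2 q.2).2 ((fracValue 1 2 q.2).2 + (fracValue 1 2 q.2).1) q.1.1 :=
    primrec_fracValue.comp (Primrec.pair (Primrec.pair (Primrec.snd.comp hB)
      (Primrec.nat_add.comp (Primrec.snd.comp hB) (Primrec.fst.comp hB)))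
      (Primrec.fst.comp Primrec.fst))
  have hX1 := Primrec.fst.comp hX
  have hX2 := Primrec.snd.comp hX
  have hY1 := Primrec.fst.comp hY
  have hY2 := Primrec.snd.comp hY
  refine Primrec.and.comp (Primrec.nat_le.comp ?_ ?_).decide (Primrec.nat_le.comp ?_ ?_).decide
  · exact Primrec.nat_mul.comp hX1 hY2
  · exact Primrec.nat_mul.comp (Primrec.nat_add.comp hY1 (Primrec.const C)) hX2
  · exact Primrec.nat_mul.comp hY1 hX2
  · exact Primrec.nat_add.comp (Primrec.nat_mul.comp hX1 hY2)
      (Primrec.nat_mul.comp (Primrec.const C) hX2)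

/-- The test is the real inequality with its positive denominators cleared, which leaves
natural-number arithmetic. -/
theorem closeTest_eq_true_iff {C : ℕ} {u v z : List Bool} :
    closeTest C u v z = true ↔
      |wordValue (1 + wordValue 2 z) u - wordValue 2 v| ≤ C * (2 : ℝ)⁻¹ ^ v.length := by
  have hB2 : (0 : ℝ) < (fracValue 1 2 z).2 := by rw [fracValue_snd]; positivity
  have hY2 : ((fracValue 1 2 v).2 : ℝ) = 2 ^ v.length := by rw [fracValue_snd]; norm_num
  have hY := fracValue_div (P := 1) (Q := 2) two_pos v
  have hB := fracValue_div (P := 1) (Q := 2) two_pos z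
  have hQ : 0 < (fracValue 1 2 z).2 + (fracValue 1 2 z).1 := by
    have : 0 < (fracValue 1 2 z).2 := by exact_mod_cast hB2
    omega
  have hX := fracValue_div (P := (fracValue 1 2 z).2) hQ u
  have hbase : (((fracValue 1 2 z).2 + (fracValue 1 2 z).1 : ℕ) : ℝ) / (fracValue 1 2 z).2
      = 1 + wordValue 2 z := by
    rw [Nat.cast_ofNat, Nat.cast_one, div_one] at hB
    rw [← hB]; push_cast; field_simp
  have hX2 : (0 : ℝ)
      < (fracValue (fracValue 1 2 z).2 ((fracValue 1 2 z).2 + (fracValue 1 2 z).1) u).2 := by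
    rw [fracValue_snd]; positivity
  rw [hbase] at hX
  rw [Nat.cast_ofNat, Nat.cast_one, div_one, hY2] at hY
  rw [closeTest, ← hX, ← hY]
  simp only [Bool.and_eq_true, decide_eq_true_eq]
  generalize fracValue (fracValue 1 2 z).2 ((fracValue 1 2 z).2 + (fracValue 1 2 z).1) u = X
    at hX2 ⊢
  rw [← Nat.cast_le (α := ℝ), ← Nat.cast_le (α := ℝ)]
  push_cast
  rw [hY2]
  have hp : (0 : ℝ) < 2 ^ v.length := by positivity
  rw [div_sub_div _ _ hX2.ne' hp.ne', abs_div, abs_of_pos (mul_pos hX2 hp),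
    div_le_iff₀ (mul_pos hX2 hp), abs_le, inv_pow]
  have : (C : ℝ) * (2 ^ v.length)⁻¹ * (X.2 * 2 ^ v.length) = C * X.2 := by field_simp
  rw [this]
  constructor <;> rintro ⟨h1, h2⟩ <;> constructor <;> linarith

/-- The prefix of a sequence in base `2` approximates its sum. -/
theorem wordValue_greedyBinary {s : ℝ} (h0 : 0 ≤ s) (h1 : s ≤ 1) (n : ℕ) :
    0 ≤ s - wordValue 2 (pre (greedyBinary s) n) ∧
      s - wordValue 2 (pre (greedyBinary s) n) ≤ (2 : ℝ)⁻¹ ^ n := by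
  have h := sum_add_greedyRem s n
  obtain ⟨h2, h3⟩ := greedyRem_mem h0 h1 n
  rw [wordValue_pre]
  have hp : (0 : ℝ) < (2 : ℝ)⁻¹ ^ n := by positivity
  have h4 := mul_nonneg hp.le h2
  have h5 := mul_le_of_le_one_right hp.le h3
  constructor <;> linarith

/-- Since N ≤ 2^N, an extra 2N bits of precision absorb the Lipschitz constant N². -/
theorem sq_mul_inv_pow_le {N n M : ℕ} (h : 2 * N + n ≤ M) :
    (N : ℝ) ^ 2 * (2 : ℝ)⁻¹ ^ M ≤ (2 : ℝ)⁻¹ ^ n := by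
  have h1 : (N : ℝ) ≤ 2 ^ N := by exact_mod_cast Nat.lt_two_pow_self.le
  calc (N : ℝ) ^ 2 * (2 : ℝ)⁻¹ ^ M ≤ (2 ^ N) ^ 2 * (2 : ℝ)⁻¹ ^ (2 * N + n) := by
        gcongr ?_ ^ 2 * ?_
        exact pow_le_pow_of_le_one (by norm_num) (by norm_num) h
    _ = (2 : ℝ)⁻¹ ^ n := by
        rw [pow_add, inv_pow, inv_pow, ← pow_mul, mul_comm N 2]
        field_simp

/-- Evaluating a word in base `β` and in its truncation gives nearly the same value. -/
theorem abs_wordValue_trunc_le {β : ℝ} (h1 : 1 ≤ β) (h2 : β ≤ 2) {u : List Bool} {n M : ℕ}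
    (h : 2 * u.length + n ≤ M) :
    |wordValue (1 + wordValue 2 (pre (greedyBinary (β - 1)) M)) u - wordValue β u|
      ≤ (2 : ℝ)⁻¹ ^ n := by
  obtain ⟨h3, h4⟩ := wordValue_greedyBinary (s := β - 1) (by linarith) (by linarith) M
  have h5 := wordValue_nonneg zero_le_two (pre (greedyBinary (β - 1)) M)
  refine (abs_wordValue_sub_le (by linarith) h1 u).trans
    (le_trans (mul_le_mul_of_nonneg_left ?_ (by positivity)) (sq_mul_inv_pow_le h))
  rw [abs_le]
  constructor <;> linarith

/-! ### Separation of the values of words -/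

/-- The integer polynomial with the digits of the word as coefficients, highest degree first. -/
def wordPoly : List Bool → ℤ[X]
  | [] => 0
  | b :: w => C (b.toNat : ℤ) * X ^ w.length + wordPoly w

theorem aeval_wordPoly {β : ℝ} (hβ : β ≠ 0) (w : List Bool) :
    aeval β (wordPoly w) = β ^ w.length * wordValue β w := by
  induction w with
  | nil => simp [wordPoly]
  | cons b w ih =>
    rw [wordPoly, map_add, ih, wordValue_cons, List.length_cons, pow_succ]
    simp
    field_simp

/-- The last digit is the constant coefficient, which is what the divisibility argument sees. -/
theorem wordPoly_append_singleton (w : List Bool) (b : Bool) :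
    wordPoly (w ++ [b]) = X * wordPoly w + C (b.toNat : ℤ) := by
  induction w with
  | nil => simp [wordPoly]
  | cons c w ih =>
    rw [List.cons_append, wordPoly, ih, wordPoly, List.length_append, List.length_singleton]
    ring

/-- The minimal polynomial divides the difference, so its constant term divides a difference of last
digits. That term has absolute value at least 2, so the digits agree; cancelling β reduces to
shorter words. -/
theorem aeval_wordPoly_injective {β : ℝ} (hβ : β ≠ 0) (hC : ClassC β) {v w : List Bool}
    (hl : v.length = w.length) (h : aeval β (wordPoly v) = aeval β (wordPoly w)) : v = w := by
  induction v using List.reverseRecOn generalizing w with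
  | nil => exact (List.length_eq_zero_iff.1 hl.symm).symm
  | append_singleton v b ih =>
    rcases List.eq_nil_or_concat' w with rfl | ⟨w, c, rfl⟩
    · simp at hl
    have hdvd : minpoly ℤ β ∣ wordPoly (v ++ [b]) - wordPoly (w ++ [c]) :=
      minpoly.isIntegrallyClosed_dvd hC.1 (by rw [map_sub, h, sub_self])
    obtain ⟨r, hr⟩ := hdvd
    have h0 := congrArg (fun p : ℤ[X] => p.coeff 0) hr
    simp only [wordPoly_append_singleton, coeff_sub, coeff_add, mul_coeff_zero, coeff_X_zero,
      zero_mul, zero_add, coeff_C_zero] at h0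
    have hbc : b = c := by
      by_contra hne
      have h1 : |((b.toNat : ℤ) - c.toNat)| = 1 := by
        clear h0 hr h
        cases b <;> cases c <;> simp at hne ⊢
      have h2 : |(minpoly ℤ β).coeff 0| ∣ 1 := by
        rw [← h1, h0, abs_mul]; exact dvd_mul_right _ _
      have h3 := Int.le_of_dvd one_pos h2
      have h4 := hC.2
      omega
    subst hbc
    rw [ih (by simpa using hl)]
    simpa [wordPoly_append_singleton, hβ] using h

theorem wordValue_injective {β : ℝ} (hβ : β ≠ 0) (hC : ClassC β) {v w : List Bool}
    (hl : v.length = w.length) (h : wordValue β v = wordValue β w) : v = w := by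
  refine aeval_wordPoly_injective hβ hC hl ?_
  rw [aeval_wordPoly hβ, aeval_wordPoly hβ, hl, h]

/-- There are |v| terms with coefficients in {-1, 0, 1}; the maximum with 1 covers conjugates inside
and outside the unit disk together. -/
theorem norm_aeval_wordPoly_sub_le (z : ℂ) {v w : List Bool} (hl : v.length = w.length) :
    ‖aeval z (wordPoly v - wordPoly w)‖ ≤ v.length * max 1 ‖z‖ ^ v.length := by
  induction v generalizing w with
  | nil => simp [wordPoly, List.length_eq_zero_iff.1 hl.symm]
  | cons b v ih =>
    cases w with
    | nil => simp at hl
    | cons c w =>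
      have hl' : v.length = w.length := by simpa using hl
      have h1 : (1 : ℝ) ≤ max 1 ‖z‖ := le_max_left _ _
      have h2 : aeval z (wordPoly (b :: v) - wordPoly (c :: w))
          = ((b.toNat : ℂ) - c.toNat) * z ^ v.length + aeval z (wordPoly v - wordPoly w) := by
        simp [wordPoly, hl']; ring
      have h3 : ‖((b.toNat : ℂ) - c.toNat)‖ ≤ 1 := by cases b <;> cases c <;> simp
      have h4 : ‖z‖ ^ v.length ≤ max 1 ‖z‖ ^ v.length := by gcongr; exact le_max_right _ _
      rw [h2]
      calc _ ≤ ‖((b.toNat : ℂ) - c.toNat) * z ^ v.length‖ + _ := norm_add_le _ _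
        _ ≤ 1 * max 1 ‖z‖ ^ v.length + v.length * max 1 ‖z‖ ^ v.length := by
          rw [norm_mul, norm_pow]
          gcongr
          exact ih hl'
        _ = (v.length + 1) * max 1 ‖z‖ ^ v.length := by ring
        _ ≤ (v.length + 1) * max 1 ‖z‖ ^ (v.length + 1) := by
          gcongr
          omega
        _ = _ := by simp

/-! ### Conjugates and the integrality of norms -/

theorem nodup_aroots_minpoly {β : ℝ} (hβ : IsIntegral ℤ β) : ((minpoly ℤ β).aroots ℂ).Nodup := by
  have h : (minpoly ℚ β).Separable := (minpoly.irreducible hβ.tower_top).separable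
  rw [minpoly.isIntegrallyClosed_eq_field_fractions' ℚ hβ] at h
  have h2 := nodup_roots (h.map (f := algebraMap ℚ ℂ))
  rwa [Polynomial.map_map, ← IsScalarTower.algebraMap_eq] at h2

theorem coe_mem_aroots_minpoly {β : ℝ} (hβ : IsIntegral ℤ β) :
    (β : ℂ) ∈ (minpoly ℤ β).aroots ℂ := by
  rw [mem_aroots]
  refine ⟨(minpoly.monic hβ).ne_zero, ?_⟩
  have := aeval_algebraMap_apply ℂ β (minpoly ℤ β)
  rw [minpoly.aeval, map_zero] at this
  exact this

theorem prod_aroots_minpoly {β : ℝ} (hβ : IsIntegral ℤ β) (f : ℂ → ℂ) :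
    (((minpoly ℤ β).aroots ℂ).map f).prod = f β * ∏ z ∈ galoisConjugates β, f z := by
  rw [galoisConjugates, Finset.mul_prod_erase _ _
    (Multiset.mem_toFinset.2 (coe_mem_aroots_minpoly hβ)), Finset.prod, Multiset.toFinset_val,
    (nodup_aroots_minpoly hβ).dedup]

theorem minpoly_eq_of_mem_aroots {β : ℝ} (hβ : IsIntegral ℤ β) {z : ℂ}
    (hz : z ∈ (minpoly ℤ β).aroots ℂ) : minpoly ℤ z = minpoly ℤ β := by
  have hz0 : aeval z (minpoly ℤ β) = 0 := (mem_aroots.1 hz).2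
  have hzi : IsIntegral ℤ z := ⟨_, minpoly.monic hβ, hz0⟩
  have hdvd := minpoly.isIntegrallyClosed_dvd hzi hz0
  exact eq_of_monic_of_associated (minpoly.monic hzi) (minpoly.monic hβ)
    ((minpoly.prime_of_isIntegrallyClosed hzi).irreducible.associated_of_dvd
      (minpoly.prime_of_isIntegrallyClosed hβ).irreducible hdvd)

/-- The product is the resultant of the minimal polynomial and q, hence an integer. It is nonzero:
if q vanished at one conjugate, the common minimal polynomial would divide q and q would vanish at
β. -/
theorem one_le_norm_prod_aeval {β : ℝ} (hβ : IsIntegral ℤ β) {q : ℤ[X]} (hq : aeval β q ≠ 0) :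
    1 ≤ ‖(((minpoly ℤ β).aroots ℂ).map fun z => aeval z q).prod‖ := by
  have hm : ((minpoly ℤ β).map (algebraMap ℤ ℂ)).Monic := (minpoly.monic hβ).map _
  have h := resultant_eq_prod_eval ((minpoly ℤ β).map (algebraMap ℤ ℂ))
    (q.map (algebraMap ℤ ℂ)) q.natDegree natDegree_map_le (IsAlgClosed.splits _)
  rw [resultant_map_map, hm.leadingCoeff, one_pow, one_mul] at h
  have h2 : (((minpoly ℤ β).map (algebraMap ℤ ℂ)).roots.map
      (q.map (algebraMap ℤ ℂ)).eval) = ((minpoly ℤ β).aroots ℂ).map fun z => aeval z q := by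
    refine Multiset.map_congr rfl fun z _ => ?_
    rw [eval_map_algebraMap]
  rw [h2] at h
  have hne : (((minpoly ℤ β).aroots ℂ).map fun z => aeval z q).prod ≠ 0 := by
    intro h0
    rw [Multiset.prod_eq_zero_iff] at h0
    obtain ⟨z, hz, hz0⟩ := Multiset.mem_map.1 h0
    have hzi : IsIntegral ℤ z := ⟨_, minpoly.monic hβ, (mem_aroots.1 hz).2⟩
    have hdvd := minpoly.isIntegrallyClosed_dvd hzi hz0
    rw [minpoly_eq_of_mem_aroots hβ hz] at hdvd
    obtain ⟨r, rfl⟩ := hdvd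
    exact hq (by simp)
  rw [← h, eq_intCast] at hne ⊢
  rw [Complex.norm_intCast]
  have h3 := Int.cast_ne_zero.1 hne
  exact_mod_cast Int.one_le_abs h3

/-- The product of the absolute values of the conjugates outside the closed unit disk. -/
def outerProd (β : ℝ) : ℝ := ∏ z ∈ outerConjugates β, ‖z‖

theorem one_lt_norm_of_mem_outerConjugates {β : ℝ} {z : ℂ} (hz : z ∈ outerConjugates β) :
    1 < ‖z‖ :=
  (Finset.mem_filter.1 hz).2

theorem one_le_outerProd (β : ℝ) : 1 ≤ outerProd β :=
  Finset.prod_induction (fun z : ℂ => ‖z‖) (1 ≤ ·)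
    (fun _ _ => one_le_mul_of_one_le_of_one_le) le_rfl
    fun _ hz => (one_lt_norm_of_mem_outerConjugates hz).le

theorem logb_outerProd (β : ℝ) : Real.logb β (outerProd β) = conjugateBound β := by
  simp only [Real.logb, conjugateBound, outerProd]
  rw [Real.log_prod fun z hz =>
    (zero_lt_one.trans (one_lt_norm_of_mem_outerConjugates hz)).ne', Finset.sum_div]

theorem prod_max_one_norm (β : ℝ) :
    ∏ z ∈ galoisConjugates β, max 1 ‖z‖ = outerProd β := by
  rw [outerProd, outerConjugates, Finset.prod_filter]
  refine Finset.prod_congr rfl fun z _ => ?_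
  split_ifs with h
  · exact max_eq_right h.le
  · exact max_eq_left (not_lt.1 h)

/-- Distinct words of the same length have separated values. -/
theorem one_le_mul_abs_wordValue_sub {β : ℝ} (hβ : 0 < β) (hC : ClassC β) {v w : List Bool}
    (hl : v.length = w.length) (hne : v ≠ w) :
    1 ≤ β ^ v.length * |wordValue β v - wordValue β w| *
      ((v.length : ℝ) ^ (galoisConjugates β).card * outerProd β ^ v.length) := by
  have hq : aeval β (wordPoly v - wordPoly w) ≠ 0 := fun h =>
    hne (aeval_wordPoly_injective hβ.ne' hC hl (by rwa [map_sub, sub_eq_zero] at h))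
  have h := one_le_norm_prod_aeval hC.1 hq
  rw [prod_aroots_minpoly hC.1 fun z => aeval z (wordPoly v - wordPoly w), norm_mul,
    norm_prod] at h
  have h1 : ‖aeval (β : ℂ) (wordPoly v - wordPoly w)‖
      = β ^ v.length * |wordValue β v - wordValue β w| := by
    have h2 := aeval_algebraMap_apply ℂ β (wordPoly v - wordPoly w)
    rw [Complex.coe_algebraMap] at h2
    rw [h2, Complex.norm_real, map_sub, aeval_wordPoly hβ.ne', aeval_wordPoly hβ.ne', ← hl,
      ← mul_sub, norm_mul, Real.norm_eq_abs, Real.norm_eq_abs, abs_of_pos (pow_pos hβ _)]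
  rw [h1] at h
  -- The factor at β is the scaled difference of values; only the other conjugates remain to be
  -- bounded.
  refine h.trans (mul_le_mul_of_nonneg_left ?_ (by positivity))
  rw [← prod_max_one_norm, ← Finset.prod_pow, ← Finset.prod_const, ← Finset.prod_mul_distrib]
  exact Finset.prod_le_prod (fun _ _ => norm_nonneg _)
    fun z _ => norm_aeval_wordPoly_sub_le z hl

theorem aeval_two_wordPoly (w : List Bool) :
    ∃ k : ℤ, (k : ℝ) = 2 ^ w.length * wordValue 2 w :=
  ⟨aeval 2 (wordPoly w), by
    rw [← aeval_wordPoly two_ne_zero]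
    simpa using (aeval_algebraMap_apply ℝ (2 : ℤ) (wordPoly w)).symm⟩

theorem minpoly_int_natCast (n : ℕ) : minpoly ℤ (n : ℝ) = X - C (n : ℤ) := by
  simpa using minpoly.eq_X_sub_C_of_algebraMap_inj (B := ℝ) (n : ℤ)
    (FaithfulSMul.algebraMap_injective ℤ ℝ)

/-- Base 2 itself is in the class, so injectivity for binary words needs no separate argument. -/
theorem classC_two : ClassC 2 := by
  have h := minpoly_int_natCast 2
  rw [Nat.cast_ofNat] at h
  refine ⟨by simpa using isIntegral_algebraMap (R := ℤ) (A := ℝ) (x := 2), ?_⟩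
  rw [h]
  simp

/-- The difference is a nonzero integer multiple of 2^{-|v|}. -/
theorem inv_two_pow_le_abs_wordValue_sub {v w : List Bool}
    (hl : v.length = w.length) (hne : v ≠ w) :
    (2 : ℝ)⁻¹ ^ v.length ≤ |wordValue 2 v - wordValue 2 w| := by
  obtain ⟨k, hk⟩ := aeval_two_wordPoly v
  obtain ⟨l, hkl⟩ := aeval_two_wordPoly w
  have hp : (0 : ℝ) < 2 ^ v.length := by positivity
  rw [← hl] at hkl
  have h0 : k - l ≠ 0 := by
    intro h0
    refine hne (wordValue_injective two_ne_zero classC_two hl ?_)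
    rw [sub_eq_zero.1 h0] at hk
    exact mul_left_cancel₀ hp.ne' (hk.symm.trans hkl)
  have h1 : (1 : ℝ) ≤ |(k - l : ℝ)| := by exact_mod_cast Int.one_le_abs h0
  rw [hk, hkl, ← mul_sub, abs_mul, abs_of_pos hp] at h1
  rwa [inv_pow, inv_le_iff_one_le_mul₀' hp]

/-- Cut the interval [t - r, t + r] into cells of length δ: each cell contains at most one value. -/
theorem card_le_of_separated {α : Type*} (S : Finset α) (f : α → ℝ) {δ t r : ℝ} (hδ : 0 < δ)
    (hr0 : 0 ≤ r)
    (hsep : ∀ a ∈ S, ∀ b ∈ S, a ≠ b → δ ≤ |f a - f b|) (hr : ∀ a ∈ S, |f a - t| ≤ r) :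
    (S.card : ℝ) ≤ 2 * r / δ + 1 := by
  have hmaps : Set.MapsTo (fun a => ⌊(f a - (t - r)) / δ⌋₊) S
      (Finset.range (⌊2 * r / δ⌋₊ + 1)) := by
    intro a ha
    rw [Finset.coe_range, Set.mem_Iio, Nat.lt_succ_iff]
    have := (abs_le.1 (hr a ha)).2
    exact Nat.floor_le_floor (div_le_div_of_nonneg_right (by linarith) hδ.le)
  have hinj : Set.InjOn (fun a => ⌊(f a - (t - r)) / δ⌋₊) S := by
    intro a ha b hb hab
    by_contra hne
    have h1 := hsep a ha b hb hne
    have ha0 : 0 ≤ (f a - (t - r)) / δ :=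
      div_nonneg (by linarith [(abs_le.1 (hr a ha)).1]) hδ.le
    have hb0 : 0 ≤ (f b - (t - r)) / δ :=
      div_nonneg (by linarith [(abs_le.1 (hr b hb)).1]) hδ.le
    have h2 := Nat.floor_le ha0
    have h3 := Nat.lt_floor_add_one ((f a - (t - r)) / δ)
    have h4 := Nat.floor_le hb0
    have h5 := Nat.lt_floor_add_one ((f b - (t - r)) / δ)
    simp only at hab
    rw [hab] at h2 h3
    have h6 : |(f a - (t - r)) / δ - (f b - (t - r)) / δ| < 1 := by
      rw [abs_lt]; constructor <;> linarith
    rw [← sub_div, abs_div, abs_of_pos hδ, div_lt_one hδ] at h6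
    have h7 : f a - (t - r) - (f b - (t - r)) = f a - f b := by ring
    rw [h7] at h6
    linarith
  have h := Finset.card_le_card_of_injOn _ hmaps hinj
  rw [Finset.card_range] at h
  have h8 := Nat.floor_le (a := 2 * r / δ) (by positivity)
  calc (S.card : ℝ) ≤ (⌊2 * r / δ⌋₊ + 1 : ℕ) := by exact_mod_cast h
    _ ≤ _ := by push_cast; linarith

/-! ### Comparison of the two expansions of a number -/

theorem value_nonneg {β : ℝ} (hβ : 0 ≤ β) (x : ℕ → Bool) : 0 ≤ value β x :=
  tsum_nonneg fun _ => by positivity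

theorem value_sub_wordValue_pre {β : ℝ} (hβ : 1 < β) (x : ℕ → Bool) (n : ℕ) :
    0 ≤ value β x - wordValue β (pre x n) ∧
      value β x - wordValue β (pre x n) ≤ β⁻¹ ^ n * (β - 1)⁻¹ := by
  have h0 : 0 < β := by linarith
  have hg : HasSum (fun i : ℕ => β⁻¹ ^ (i + 1)) (β - 1)⁻¹ := by
    have h := (hasSum_geometric_of_lt_one (inv_nonneg.2 h0.le) (inv_lt_one_of_one_lt₀ hβ)).mul_left
      β⁻¹
    have h1 : β⁻¹ * (1 - β⁻¹)⁻¹ = (β - 1)⁻¹ := by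
      rw [← mul_inv, mul_sub, mul_one, mul_inv_cancel₀ h0.ne']
    rw [h1] at h
    simpa only [pow_succ'] using h
  have hle (i : ℕ) : ((x i).toNat : ℝ) * β⁻¹ ^ (i + 1) ≤ β⁻¹ ^ (i + 1) :=
    mul_le_of_le_one_left (by positivity) (boolToNat_le_one _)
  have hs : Summable fun i : ℕ => ((x i).toNat : ℝ) * β⁻¹ ^ (i + 1) :=
    Summable.of_nonneg_of_le (fun i => by positivity) hle hg.summable
  have heq : value β x - wordValue β (pre x n)
      = ∑' i : ℕ, ((x (i + n)).toNat : ℝ) * β⁻¹ ^ (i + n + 1) := by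
    rw [wordValue_pre, value, ← hs.sum_add_tsum_nat_add n, add_sub_cancel_left]
  rw [heq]
  refine ⟨tsum_nonneg fun i => by positivity, ?_⟩
  rw [← (hg.mul_left (β⁻¹ ^ n)).tsum_eq]
  refine Summable.tsum_le_tsum (fun i => (hle (i + n)).trans_eq (by ring))
    ((summable_nat_add_iff n).2 hs) (hg.mul_left _).summable

/-- β^{n log_β 2} = 2^n, and the ceiling adds less than one to the exponent, hence at most a factor
β. -/
theorem pow_scaledLength {β : ℝ} (hβ : 1 < β) (n : ℕ) :
    (2 : ℝ) ^ n ≤ β ^ scaledLength β n ∧ β ^ scaledLength β n ≤ β * 2 ^ n := by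
  have h0 : 0 < β := by linarith
  have hL : 0 < Real.logb β 2 := Real.logb_pos hβ one_lt_two
  have h1 : (2 : ℝ) ^ n = β ^ ((n : ℝ) * Real.logb β 2) := by
    rw [mul_comm, Real.rpow_mul h0.le, Real.rpow_logb h0 hβ.ne' two_pos, Real.rpow_natCast]
  rw [h1, ← Real.rpow_natCast β (scaledLength β n)]
  constructor
  · exact Real.rpow_le_rpow_of_exponent_le hβ.le (Nat.le_ceil _)
  · rw [mul_comm, ← Real.rpow_add_one h0.ne']
    exact Real.rpow_le_rpow_of_exponent_le hβ.le (Nat.ceil_lt_add_one (by positivity)).le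

theorem le_scaledLength {β : ℝ} (hβ : 1 < β) (hβ2 : β < 2) (n : ℕ) : n ≤ scaledLength β n := by
  have h : (1 : ℝ) ≤ Real.logb β 2 := by
    rw [Real.le_logb_iff_rpow_le hβ two_pos, Real.rpow_one]; exact hβ2.le
  have h2 : (n : ℝ) ≤ scaledLength β n :=
    (le_mul_of_one_le_right n.cast_nonneg h).trans (Nat.le_ceil _)
  exact_mod_cast h2

theorem abs_wordValue_pre_sub_le {β : ℝ} (hβ : 1 < β) {x : ℕ → Bool} (hx : x ∈ Omega β) (n : ℕ) :
    |wordValue β (pre x (scaledLength β n)) - wordValue 2 (pre (greedyBinary (value β x)) n)|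
      ≤ (1 + (β - 1)⁻¹) * (2 : ℝ)⁻¹ ^ n := by
  obtain ⟨h1, h2⟩ := value_sub_wordValue_pre hβ x (scaledLength β n)
  obtain ⟨h3, h4⟩ := wordValue_greedyBinary (value_nonneg (by linarith) x) hx n
  have h5 : β⁻¹ ^ scaledLength β n ≤ (2 : ℝ)⁻¹ ^ n := by
    rw [inv_pow, inv_pow]
    exact inv_anti₀ (by positivity) (pow_scaledLength hβ n).1
  have hb : 0 ≤ (β - 1)⁻¹ := inv_nonneg.2 (by linarith)
  have h6 := mul_le_mul_of_nonneg_right h5 hb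
  have h7 : (0 : ℝ) < (2 : ℝ)⁻¹ ^ n := by positivity
  have h8 := mul_nonneg h7.le hb
  rw [abs_le]
  constructor <;> nlinarith

/-- The precision at which prefixes of the two expansions are compared. -/
def precision (β : ℝ) : ℕ := ⌈1 + (β - 1)⁻¹⌉₊ + 1

/-- The tails of the two expansions account for 1 + (β - 1)⁻¹ in `precision`; its final + 1 pays for
replacing β by the base read from the oracle. -/
theorem closeTest_pre {β : ℝ} (hβ : 1 < β) (hβ2 : β < 2) {x : ℕ → Bool} (hx : x ∈ Omega β)
    (n : ℕ) :
    closeTest (precision β) (pre x (scaledLength β n)) (pre (greedyBinary (value β x)) n)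
      (pre (greedyBinary (β - 1)) (2 * (scaledLength β n + n))) = true := by
  rw [closeTest_eq_true_iff, length_pre]
  have h1 := abs_wordValue_pre_sub_le hβ hx n
  have h2 := abs_wordValue_trunc_le hβ.le hβ2.le (u := pre x (scaledLength β n)) (n := n)
    (M := 2 * (scaledLength β n + n)) (by rw [length_pre]; omega)
  have h3 := Nat.le_ceil (1 + (β - 1)⁻¹)
  have h4 := mul_le_mul_of_nonneg_right h3 (show (0 : ℝ) ≤ (2 : ℝ)⁻¹ ^ n by positivity)
  refine (abs_sub_le _ (wordValue β (pre x (scaledLength β n))) _).trans ?_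
  rw [precision]
  push_cast
  linarith

theorem nodup_candidates (R : List Bool → List Bool → List Bool → Bool) (a : List Bool) (L : ℕ)
    (z : List Bool) : (candidates R a L z).Nodup :=
  (nodup_allWords L).filter _

theorem length_candidates_binary_le (C : ℕ) (u z : List Bool) (n : ℕ) :
    ((candidates (closeTest C) u n z).length : ℝ) ≤ 2 * C + 1 := by
  rw [← List.toFinset_card_of_nodup (nodup_candidates _ _ _ _)]
  have hp : (0 : ℝ) < (2 : ℝ)⁻¹ ^ n := by positivity
  refine (card_le_of_separated _ (wordValue 2) hp (r := C * (2 : ℝ)⁻¹ ^ n)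
    (t := wordValue (1 + wordValue 2 z) u) (by positivity) ?_ ?_).trans_eq ?_
  · intro a ha b hb hab
    have ha' := (mem_candidates.1 (List.mem_toFinset.1 ha)).1
    have hb' := (mem_candidates.1 (List.mem_toFinset.1 hb)).1
    have := inv_two_pow_le_abs_wordValue_sub (ha'.trans hb'.symm) hab
    rwa [ha'] at this
  · intro a ha
    obtain ⟨h1, h2⟩ := mem_candidates.1 (List.mem_toFinset.1 ha)
    rw [closeTest_eq_true_iff, h1] at h2
    rwa [abs_sub_comm]
  · field_simp

/-- The test uses the truncated base while separation holds in base β; passing between them enlarges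
the radius from C 2^{-n} to (C + 1) 2^{-n}. -/
theorem length_candidates_beta_le {β : ℝ} (hβ : 1 < β) (hβ2 : β < 2) (hC : ClassC β) (C : ℕ)
    {v : List Bool} {n : ℕ} (hv : v.length = n) (hn : 1 ≤ n) :
    ((candidates (fun a b => closeTest C b a) v (scaledLength β n)
      (pre (greedyBinary (β - 1)) (2 * (n + scaledLength β n)))).length : ℝ) ≤
      (2 * (C + 1) * β + 1) * ((scaledLength β n : ℝ) ^ (galoisConjugates β).card *
        outerProd β ^ scaledLength β n) := by
  set N := scaledLength β n with hN
  have hN1 : 1 ≤ N := hn.trans (le_scaledLength hβ hβ2 n)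
  have hβ0 : 0 < β := by linarith
  set Q := (N : ℝ) ^ (galoisConjugates β).card * outerProd β ^ N with hQ
  -- Here n ≥ 1 matters, through N ≥ 1: at N = 0 the power N^d could vanish. Q ≥ 1 later absorbs the
  -- + 1 of the counting bound.
  have hQ1 : 1 ≤ Q := one_le_mul_of_one_le_of_one_le (one_le_pow₀ (by exact_mod_cast hN1))
    (one_le_pow₀ (one_le_outerProd β))
  have hQ0 : 0 < Q := by linarith
  rw [← List.toFinset_card_of_nodup (nodup_candidates _ _ _ _)]
  have hδ : 0 < (β ^ N * Q)⁻¹ := by positivity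
  refine (card_le_of_separated _ (wordValue β) hδ (r := (C + 1) * (2 : ℝ)⁻¹ ^ n)
    (t := wordValue 2 v) (by positivity) ?_ ?_).trans ?_
  · intro a ha b hb hab
    have ha' := (mem_candidates.1 (List.mem_toFinset.1 ha)).1
    have hb' := (mem_candidates.1 (List.mem_toFinset.1 hb)).1
    have h := one_le_mul_abs_wordValue_sub hβ0 hC (ha'.trans hb'.symm) hab
    rw [ha', ← hQ] at h
    rw [inv_le_iff_one_le_mul₀' (by positivity)]
    linarith
  · intro a ha
    obtain ⟨h1, h2⟩ := mem_candidates.1 (List.mem_toFinset.1 ha)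
    rw [closeTest_eq_true_iff, hv] at h2
    have h3 := abs_wordValue_trunc_le hβ.le hβ2.le (u := a) (n := n)
      (M := 2 * (n + N)) (by omega)
    rw [abs_sub_comm] at h3
    refine (abs_sub_le _ _ _).trans ((add_le_add h3 h2).trans_eq ?_)
    ring
  · have h1 := (pow_scaledLength hβ n).2
    rw [← hN] at h1
    have h2 : (2 : ℝ)⁻¹ ^ n * β ^ N ≤ β := by
      rw [inv_pow, inv_mul_le_iff₀ (by positivity)]; linarith
    rw [div_inv_eq_mul]
    calc 2 * ((C + 1) * (2 : ℝ)⁻¹ ^ n) * (β ^ N * Q) + 1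
        = 2 * (C + 1) * ((2 : ℝ)⁻¹ ^ n * β ^ N) * Q + 1 := by ring
      _ ≤ 2 * (C + 1) * β * Q + Q := by gcongr
      _ = _ := by ring

theorem clog_le_logb_add_one {m : ℕ} {B : ℝ} (hm : (m : ℝ) ≤ B) (hB : 1 ≤ B) :
    (Nat.clog 2 m : ℝ) ≤ Real.logb 2 B + 1 := by
  have hB0 : 0 ≤ Real.logb 2 B := Real.logb_nonneg one_lt_two hB
  have h := Real.natCeil_logb_natCast 2 m
  rw [← h]
  rcases Nat.eq_zero_or_pos m with rfl | hm0
  · simp; linarith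
  · have h1 : (1 : ℝ) ≤ m := by exact_mod_cast hm0
    have h2 : Real.logb 2 m ≤ Real.logb 2 B :=
      Real.logb_le_logb_of_le one_lt_two (by positivity) hm
    have h3 := Nat.ceil_lt_add_one (Real.logb_nonneg one_lt_two h1)
    push_cast
    linarith

/-! ### Bounds for the complexity gap and their limits -/

section

variable {U : List Bool → (ℕ → Bool) → Part (List Bool)}

theorem exists_le_complexityGap (hU : IsUniversal U) {β : ℝ} (hβ : 1 < β) (hβ2 : β < 2) :
    ∃ A : ℝ, ∀ x ∈ Omega β, ∀ n : ℕ,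
      -((A + 4 * Real.logb 2 (scaledLength β n + 1)) / n) ≤ complexityGap U β x n := by
  obtain ⟨c, hc⟩ := exists_complexity_le_add_clog hU (primrec_closeTest (precision β))
  -- The 1 rounds up the logarithm of the candidate count and the 4 rounds up the four copies of the
  -- length logarithm.
  refine ⟨Real.logb 2 (2 * precision β + 1) + 1 + 4 + c, fun x hx n => ?_⟩
  have h := hc (greedyBinary (β - 1)) (pre x (scaledLength β n))
    (pre (greedyBinary (value β x)) n)
  simp only [length_pre] at h
  have h1 := h (closeTest_pre hβ hβ2 hx n)
  have h2 : (Nat.clog 2 (candidates (closeTest (precision β)) (pre x (scaledLength β n)) n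
      (pre (greedyBinary (β - 1)) (2 * (scaledLength β n + n)))).length : ℝ) ≤
      Real.logb 2 (2 * precision β + 1) + 1 :=
    clog_le_logb_add_one (length_candidates_binary_le _ _ _ _)
      (le_add_of_nonneg_left (by positivity))
  have h3 : (Nat.clog 2 (n + 1) : ℝ) ≤ Real.logb 2 (scaledLength β n + 1) + 1 :=
    clog_le_logb_add_one (by exact_mod_cast Nat.succ_le_succ (le_scaledLength hβ hβ2 n))
      (le_add_of_nonneg_left (by positivity))
  have h4 : (complexity U (pre (greedyBinary (value β x)) n) (greedyBinary (β - 1)) : ℝ) ≤ _ :=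
    Nat.cast_le.2 h1
  push_cast at h4
  rw [complexityGap, ← neg_div]
  refine div_le_div_of_nonneg_right ?_ n.cast_nonneg
  simp only [complexityRel]
  linarith

theorem exists_complexityGap_le (hU : IsUniversal U) {β : ℝ} (hβ : 1 < β) (hβ2 : β < 2)
    (hC : ClassC β) :
    ∃ A B : ℝ, ∀ x ∈ Omega β, ∀ n : ℕ, 1 ≤ n →
      complexityGap U β x n ≤ (A + B * Real.logb 2 (scaledLength β n + 1)
        + scaledLength β n * Real.logb 2 (outerProd β)) / n := by
  have hR : Primrec fun q : (List Bool × List Bool) × List Bool =>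
      closeTest (precision β) q.1.2 q.1.1 q.2 :=
    (primrec_closeTest (precision β)).comp (Primrec.pair (Primrec.pair
      (Primrec.snd.comp Primrec.fst) (Primrec.fst.comp Primrec.fst)) Primrec.snd)
  obtain ⟨c, hc⟩ := exists_complexity_le_add_clog hU
    (R := fun a b => closeTest (precision β) b a) hR
  set D : ℝ := 2 * (precision β + 1) * β + 1 with hD
  set d := (galoisConjugates β).card
  -- In the coefficient of the logarithm, d comes from the factor N^d in the candidate count and 4
  -- from coding the lengths.
  refine ⟨Real.logb 2 D + 1 + 4 + c, d + 4, fun x hx n hn => ?_⟩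
  have h := hc (greedyBinary (β - 1)) (pre (greedyBinary (value β x)) n)
    (pre x (scaledLength β n))
  simp only [length_pre] at h
  have h1 := h (by rw [add_comm n]; exact closeTest_pre hβ hβ2 hx n)
  set N := scaledLength β n
  have hN : 1 ≤ N := hn.trans (le_scaledLength hβ hβ2 n)
  have hN' : (1 : ℝ) ≤ N := by exact_mod_cast hN
  have hP := one_le_outerProd β
  have hD1 : 1 ≤ D := le_add_of_nonneg_left (by positivity)
  have hNd : (1 : ℝ) ≤ (N : ℝ) ^ d := one_le_pow₀ hN'
  have hPN : 1 ≤ outerProd β ^ N := one_le_pow₀ hP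
  have hQ : 1 ≤ (N : ℝ) ^ d * outerProd β ^ N := one_le_mul_of_one_le_of_one_le hNd hPN
  have h2 := clog_le_logb_add_one (length_candidates_beta_le hβ hβ2 hC (precision β)
    (length_pre (greedyBinary (value β x)) n) hn) (one_le_mul_of_one_le_of_one_le hD1 hQ)
  rw [← hD, Real.logb_mul (by positivity) (by positivity),
    Real.logb_mul (by positivity) (by positivity), Real.logb_pow, Real.logb_pow] at h2
  have h3 : (Nat.clog 2 (N + 1) : ℝ) ≤ Real.logb 2 (N + 1) + 1 :=
    clog_le_logb_add_one (by push_cast; rfl) (le_add_of_nonneg_left (by positivity))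
  have h5 : (d : ℝ) * Real.logb 2 N ≤ d * Real.logb 2 (N + 1) :=
    mul_le_mul_of_nonneg_left
      (Real.logb_le_logb_of_le one_lt_two (by positivity) (by linarith)) d.cast_nonneg
  have h4 : (complexity U (pre x N) (greedyBinary (β - 1)) : ℝ) ≤ _ := Nat.cast_le.2 h1
  push_cast at h4
  rw [complexityGap]
  refine div_le_div_of_nonneg_right ?_ n.cast_nonneg
  simp only [complexityRel]
  linarith

theorem tendsto_scaledLength_div {β : ℝ} (hβ : 1 < β) :
    Tendsto (fun n : ℕ => (scaledLength β n : ℝ) / n) atTop (nhds (Real.logb β 2)) := by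
  have h := (tendsto_nat_ceil_mul_div_atTop (Real.logb_pos hβ one_lt_two).le).comp
    (tendsto_natCast_atTop_atTop (R := ℝ))
  refine h.congr fun n => ?_
  simp [scaledLength, mul_comm]

/-- Factor log(N + 1)/n as log(N + 1)/(N + 1) times (N + 1)/n: the first tends to 0 and the second
converges. -/
theorem tendsto_logb_scaledLength_div {β : ℝ} (hβ : 1 < β) (hβ2 : β < 2) :
    Tendsto (fun n : ℕ => Real.logb 2 (scaledLength β n + 1) / n) atTop (nhds 0) := by
  have hN : Tendsto (fun n : ℕ => (scaledLength β n : ℝ) + 1) atTop atTop :=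
    tendsto_atTop_mono (fun n => (Nat.cast_le.2 (le_scaledLength hβ hβ2 n)).trans (by linarith))
      tendsto_natCast_atTop_atTop
  have h1 := (Real.isLittleO_log_id_atTop.tendsto_div_nhds_zero).comp hN
  have h2 := (tendsto_scaledLength_div hβ).add (tendsto_one_div_atTop_nhds_zero_nat (𝕜 := ℝ))
  have h3 := (h1.mul h2).div_const (Real.log 2)
  rw [zero_mul, zero_div] at h3
  refine h3.congr fun n => ?_
  have h4 : (scaledLength β n : ℝ) + 1 ≠ 0 := by positivity
  simp only [Function.comp_apply, id, Real.logb]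
  rw [← add_div]
  field_simp

theorem zero_le_lowerDelta (hU : IsUniversal U) {β : ℝ} (hβ : 1 < β) (hβ2 : β < 2)
    {x : ℕ → Bool} (hx : x ∈ Omega β) : 0 ≤ lowerDelta U β x := by
  obtain ⟨A, hA⟩ := exists_le_complexityGap hU hβ hβ2
  have h : Tendsto (fun n : ℕ => -((A + 4 * Real.logb 2 (scaledLength β n + 1)) / n)) atTop
      (nhds (0 : ℝ)) := by
    have := ((tendsto_const_div_atTop_nhds_zero_nat A).add
      ((tendsto_logb_scaledLength_div hβ hβ2).const_mul 4)).neg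
    simp only [mul_zero, add_zero, neg_zero] at this
    exact this.congr fun n => by ring
  have h2 := ((continuous_coe_real_ereal.tendsto _).comp h).liminf_eq
  rw [EReal.coe_zero] at h2
  rw [← h2]
  exact liminf_le_liminf (Eventually.of_forall fun n => EReal.coe_le_coe_iff.2 (hA x hx n))

theorem upperDelta_le (hU : IsUniversal U) {β : ℝ} (hβ : 1 < β) (hβ2 : β < 2)
    (hC : ClassC β) {x : ℕ → Bool} (hx : x ∈ Omega β) :
    upperDelta U β x ≤ ((conjugateBound β : ℝ) : EReal) := by
  obtain ⟨A, B, hA⟩ := exists_complexityGap_le hU hβ hβ2 hC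
  have h : Tendsto (fun n : ℕ => (A + B * Real.logb 2 (scaledLength β n + 1)
        + scaledLength β n * Real.logb 2 (outerProd β)) / n) atTop
      (nhds (conjugateBound β)) := by
    have := ((tendsto_const_div_atTop_nhds_zero_nat A).add
      ((tendsto_logb_scaledLength_div hβ hβ2).const_mul B)).add
      ((tendsto_scaledLength_div hβ).mul_const (Real.logb 2 (outerProd β)))
    -- Change of base: log_β 2 · log_2 P = log_β P.
    rw [mul_zero, add_zero, zero_add, Real.mul_logb two_ne_zero (by norm_num) (by norm_num),
      logb_outerProd] at this
    exact this.congr fun n => by ring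
  rw [← ((continuous_coe_real_ereal.tendsto _).comp h).limsup_eq]
  refine limsup_le_limsup ?_
  filter_upwards [eventually_ge_atTop 1] with n hn
  exact EReal.coe_le_coe_iff.2 (hA x hx n hn)

theorem lowerDelta_le_upperDelta (β : ℝ) (x : ℕ → Bool) :
    lowerDelta U β x ≤ upperDelta U β x :=
  liminf_le_limsup

end

/-! ### Roots of integers -/

section Radical

variable {β : ℝ} {k m : ℕ}

theorem aeval_X_pow_sub_C_eq_zero (h : β ^ m = k) : aeval β (X ^ m - C (k : ℤ) : ℤ[X]) = 0 := by
  simp [h]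

theorem isIntegral_of_pow_eq_natCast (hm : m ≠ 0) (h : β ^ m = k) : IsIntegral ℤ β :=
  ⟨_, monic_X_pow_sub_C (k : ℤ) hm, aeval_X_pow_sub_C_eq_zero h⟩

/-- Every conjugate is also a root of X^m - k, whether or not that polynomial is irreducible. -/
theorem norm_eq_of_mem_aroots (hβ : 0 ≤ β) (hm : m ≠ 0) (h : β ^ m = k) {z : ℂ}
    (hz : z ∈ (minpoly ℤ β).aroots ℂ) : ‖z‖ = β := by
  obtain ⟨r, hr⟩ := minpoly.isIntegrallyClosed_dvd (isIntegral_of_pow_eq_natCast hm h)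
    (aeval_X_pow_sub_C_eq_zero h)
  have h0 : aeval z (X ^ m - C (k : ℤ) : ℤ[X]) = 0 := by
    rw [hr, map_mul, (mem_aroots.1 hz).2, zero_mul]
  have h1 : z ^ m = k := by simpa [sub_eq_zero] using h0
  have h2 : ‖z‖ ^ m = β ^ m := by rw [← norm_pow, h1, h]; simp
  exact (pow_left_inj₀ (norm_nonneg _) hβ hm).1 h2

/-- Each conjugate has modulus β > 1, so it lies outside the disk and contributes log_β β = 1. -/
theorem conjugateBound_of_pow_eq_natCast (hβ : 1 < β) (hm : m ≠ 0) (h : β ^ m = k) :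
    conjugateBound β = (minpoly ℤ β).natDegree - 1 := by
  have hi := isIntegral_of_pow_eq_natCast hm h
  have hnorm {z : ℂ} (hz : z ∈ galoisConjugates β) : ‖z‖ = β :=
    norm_eq_of_mem_aroots (by linarith) hm h
      (Multiset.mem_toFinset.1 (Finset.mem_of_mem_erase hz))
  have hout : outerConjugates β = galoisConjugates β :=
    Finset.filter_true_of_mem fun z hz => by rw [hnorm hz]; exact hβ
  have hcard : (galoisConjugates β).card + 1 = (minpoly ℤ β).natDegree := by
    rw [galoisConjugates, Finset.card_erase_add_one
      (Multiset.mem_toFinset.2 (coe_mem_aroots_minpoly hi)),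
      Multiset.toFinset_card_of_nodup (nodup_aroots_minpoly hi), aroots,
      ← (IsAlgClosed.splits _).natDegree_eq_card_roots, (minpoly.monic hi).natDegree_map]
  rw [conjugateBound, hout, Finset.sum_congr rfl fun z hz => by
    rw [hnorm hz, Real.logb_self_eq_one hβ], ← hcard]
  simp

theorem natDegree_minpoly_le (hm : m ≠ 0) (h : β ^ m = k) : (minpoly ℤ β).natDegree ≤ m := by
  have h1 := natDegree_le_of_dvd (minpoly.isIntegrallyClosed_dvd
    (isIntegral_of_pow_eq_natCast hm h) (aeval_X_pow_sub_C_eq_zero h))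
    (monic_X_pow_sub_C (k : ℤ) hm).ne_zero
  rwa [natDegree_X_pow_sub_C] at h1

/-- The absolute value of the constant term is the product of the moduli of the roots, hence at
least β > 1; being an integer, it is at least 2. -/
theorem classC_of_pow_eq_natCast (hβ : 1 < β) (hm : m ≠ 0) (h : β ^ m = k) : ClassC β := by
  have hi := isIntegral_of_pow_eq_natCast hm h
  refine ⟨hi, ?_⟩
  have hsplit := IsAlgClosed.splits ((minpoly ℤ β).map (algebraMap ℤ ℂ))
  have h1 := hsplit.coeff_zero_eq_prod_roots_of_monic ((minpoly.monic hi).map _)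
  have h2 := prod_aroots_minpoly hi fun z => z
  rw [Multiset.map_id', aroots] at h2
  rw [h2, coeff_map, eq_intCast] at h1
  have h3 := congrArg norm h1
  rw [Complex.norm_intCast, norm_mul, norm_pow, norm_neg, norm_one, one_pow, one_mul, norm_mul,
    norm_prod, Complex.norm_real, Real.norm_of_nonneg (by linarith)] at h3
  have h4 : 1 ≤ ∏ z ∈ galoisConjugates β, ‖z‖ := by
    refine Finset.prod_induction (fun z : ℂ => ‖z‖) (1 ≤ ·)
      (fun _ _ => one_le_mul_of_one_le_of_one_le) le_rfl fun z hz => ?_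
    rw [norm_eq_of_mem_aroots (by linarith) hm h
      (Multiset.mem_toFinset.1 (Finset.mem_of_mem_erase hz))]
    exact hβ.le
  have h5 : (1 : ℝ) < |((minpoly ℤ β).coeff 0 : ℝ)| := by
    rw [h3]; nlinarith
  exact_mod_cast h5

theorem minpoly_eq_X_pow_sub_C (hm : m ≠ 0) (h : β ^ m = k)
    (hirr : Irreducible (X ^ m - C (k : ℤ) : ℤ[X])) : minpoly ℤ β = X ^ m - C (k : ℤ) := by
  have hi := isIntegral_of_pow_eq_natCast hm h
  exact eq_of_monic_of_associated (minpoly.monic hi) (monic_X_pow_sub_C (k : ℤ) hm)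
    ((minpoly.prime_of_isIntegrallyClosed hi).irreducible.associated_of_dvd hirr
      (minpoly.isIntegrallyClosed_dvd hi (aeval_X_pow_sub_C_eq_zero h)))

end Radical

end BetaExp

end

open BetaExp in
theorem mainTheorem8 (U : List Bool → (ℕ → Bool) → Part (List Bool)) (hU : IsUniversal U) :
    (∀ β : ℝ, 1 < β → β < 2 → ClassC β →
      (∀ v w : List Bool, BetaEquiv β v w → v = w) ∧
      (∀ (x : ℕ → Bool) (n : ℕ), IsGreatest {w : List Bool | BetaEquiv β (pre x n) w} (pre x n)) ∧
      ∀ x ∈ Omega β,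
        0 ≤ lowerDelta U β x ∧ lowerDelta U β x ≤ upperDelta U β x ∧
          upperDelta U β x ≤ ((conjugateBound β : ℝ) : EReal)) ∧
    (∀ (k m : ℕ) (β : ℝ), 2 ≤ k → 1 ≤ m → β = (k : ℝ) ^ ((1 : ℝ) / m) → β < 2 →
      1 < β ∧ ClassC β ∧
      (Irreducible (X ^ m - C (k : ℤ) : ℤ[X]) →
        minpoly ℤ β = X ^ m - C (k : ℤ) ∧ conjugateBound β = (m : ℝ) - 1) ∧
      ∀ x ∈ Omega β,
        0 ≤ lowerDelta U β x ∧ lowerDelta U β x ≤ upperDelta U β x ∧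
          upperDelta U β x ≤ (((m : ℝ) - 1 : ℝ) : EReal)) := by
  have main : ∀ β : ℝ, 1 < β → β < 2 → ClassC β → ∀ x ∈ Omega β,
      0 ≤ lowerDelta U β x ∧ lowerDelta U β x ≤ upperDelta U β x ∧
        upperDelta U β x ≤ ((conjugateBound β : ℝ) : EReal) := fun β h1 h2 hC x hx =>
    ⟨zero_le_lowerDelta hU h1 h2 hx, lowerDelta_le_upperDelta β x, upperDelta_le hU h1 h2 hC hx⟩
  have inj : ∀ β : ℝ, 1 < β → ClassC β → ∀ v w : List Bool, BetaEquiv β v w → v = w :=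
    fun β h1 hC v w h => wordValue_injective (by linarith) hC h.1 h.2
  refine ⟨fun β h1 h2 hC => ⟨inj β h1 hC, fun x n => ⟨⟨rfl, rfl⟩, fun w hw => ?_⟩,
    main β h1 h2 hC⟩, fun k m β hk hm hβ h2 => ?_⟩
  -- By injectivity the class of the prefix is a singleton, so maximality is trivial.
  · exact (inj β h1 hC _ _ hw).ge
  · have hm0 : m ≠ 0 := by omega
    have h1 : 1 < β := by
      rw [hβ]
      exact Real.one_lt_rpow (by exact_mod_cast hk) (by positivity)
    have hpow : β ^ m = k := by
      rw [hβ, one_div, Real.rpow_inv_natCast_pow k.cast_nonneg hm0]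
    have hC := classC_of_pow_eq_natCast h1 hm0 hpow
    have hbound := conjugateBound_of_pow_eq_natCast h1 hm0 hpow
    refine ⟨h1, hC, fun hirr => ?_, fun x hx => ?_⟩
    · have hmin := minpoly_eq_X_pow_sub_C hm0 hpow hirr
      refine ⟨hmin, ?_⟩
      rw [hbound, hmin, natDegree_X_pow_sub_C]
    · obtain ⟨h3, h4, h5⟩ := main β h1 h2 hC x hx
      -- Without irreducibility the degree may be smaller than m, which only improves the bound.
      refine ⟨h3, h4, h5.trans (EReal.coe_le_coe_iff.2 ?_)⟩
      rw [hbound]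
      have : ((minpoly ℤ β).natDegree : ℝ) ≤ m := by
        exact_mod_cast natDegree_minpoly_le hm0 hpow
      linarith
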